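/- Let $S_1,S_2$ be two isometries on a nonzero complex Hilbert space $H$ with $S_1S_1^*+S_2S_2^*=1$, so that the C*-algebra $C^*(S_1,S_2)\subseteq B(H)$ they generate is the Cuntz algebra $\mathcal{O}_2$ (which, up to *-isomorphism, does not depend on the choice of such $H,S_1,S_2$). Then there is a unique *-automorphism $\sigma$ of $\mathcal{O}_2=C^*(S_1,S_2)$ of order two with $\sigma(S_1)=S_2$. Put $$T=\tfrac{1}{\sqrt2}(S_1+S_2),\qquad U=S_1S_1^*-S_2S_2^*,\qquad V=UTU .$$ Then $V=\tfrac{1}{\sqrt2}(S_1-S_2)(S_1S_1^*-S_2S_2^*)$, and the fixed-point C*-algebra $[\mathcal{O}_2]_1=\{a\in\mathcal{O}_2:\sigma(a)=a\}$ is equal to $C^*(T,V)$ and is *-isomorphic to $\mathcal{O}_2$, that is, to $C^*(S_1,S_2)$ and, more generally, to $C^*(R_1,R_2)$ for any two isometries $R_1,R_2$ on a nonzero complex Hilbert space with $R_1R_1^*+R_2R_2^*=1$. -/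

import Mathlib

/-- Two bounded operators on a Hilbert space satisfy the Cuntz relation: both are isometries and
the sum of their range projections is the identity (`star` is the Hilbert space adjoint). -/
structure IsCuntzPair {H : Type*} [NormedAddCommGroup H] [InnerProductSpace ℂ H] [CompleteSpace H]
    (S₁ S₂ : H →L[ℂ] H) : Prop where
  isometry₁ : Isometry S₁
  isometry₂ : Isometry S₂
  sum_eq_one : S₁ * star S₁ + S₂ * star S₂ = 1

/-- The C*-subalgebra `C*(a, b)` generated by two elements: the closure of the unital star
subalgebra generated by them. (It is only used for pairs of isometries, so that the unit
`star a * a = 1` belongs to the non-unital subalgebra generated by `a` and `b` anyway.) -/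
def cstarGen {B : Type*} [TopologicalSpace B] [Ring B] [StarRing B] [Algebra ℂ B] [StarModule ℂ B]
    [IsTopologicalRing B] [ContinuousStar B] (a b : B) : StarSubalgebra ℂ B :=
  (StarAlgebra.adjoin ℂ {a, b}).topologicalClosure

section Gen

variable {B : Type*} [TopologicalSpace B] [Ring B] [StarRing B] [Algebra ℂ B] [StarModule ℂ B]
  [IsTopologicalRing B] [ContinuousStar B]

theorem left_mem_cstarGen (a b : B) : a ∈ cstarGen a b :=
  StarSubalgebra.le_topologicalClosure _ (StarAlgebra.subset_adjoin ℂ _ (by simp))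

theorem right_mem_cstarGen (a b : B) : b ∈ cstarGen a b :=
  StarSubalgebra.le_topologicalClosure _ (StarAlgebra.subset_adjoin ℂ _ (by simp))

/-- The first generator, as an element of `C*(a, b)`. -/
def cstarGen.fst (a b : B) : cstarGen a b := ⟨a, left_mem_cstarGen a b⟩

/-- The second generator, as an element of `C*(a, b)`. -/
def cstarGen.snd (a b : B) : cstarGen a b := ⟨b, right_mem_cstarGen a b⟩

end Gen

/-- The fixed-point subalgebra of a *-automorphism. -/
def fixedPointAlgebra {A : Type*} [Ring A] [StarRing A] [Algebra ℂ A] [StarModule ℂ A]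
    (σ : A ≃⋆ₐ[ℂ] A) : StarSubalgebra ℂ A where
  carrier := {a | σ a = a}
  mul_mem' {a b} ha hb := by simp only [Set.mem_ofPred_eq] at *; rw [map_mul, ha, hb]
  one_mem' := map_one σ
  add_mem' {a b} ha hb := by simp only [Set.mem_ofPred_eq] at *; rw [map_add, ha, hb]
  zero_mem' := map_zero σ
  algebraMap_mem' r := by
    simp only [Set.mem_ofPred_eq, Algebra.algebraMap_eq_smul_one]
    rw [map_smul, map_one]
  star_mem' {a} ha := by simp only [Set.mem_ofPred_eq] at *; rw [map_star, ha]

/-! Two facts are combined: a *-homomorphism into a nonzero C*-algebra is isometric on the algebra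
generated by a Cuntz pair, and `T`, `V` is again a Cuntz pair generating the fixed points.

For the first, products `μ ν*` of words of equal length span a finite-dimensional algebra on which
the map is injective, hence isometric. A polynomial of degree `n` in the generators splits into `2n
+ 1` homogeneous parts, each recovered by compressing with isometries of orthogonal ranges
(`norm_le_mul_norm_map`). The norm therefore drops by a factor of at most `2n + 1`, and applying
this to high powers of `x* x` removes the factor. Uniqueness of `O₂` follows by projecting the Cuntz
pair in `A × B` to both factors (`exists_equiv`).

For the second, `U` is a symmetry that `σ` negates and whose conjugation exchanges `T` and `V`. So
`C*(T, V) + C*(T, V) U` is a *-algebra containing the generators, and averaging over `σ` kills its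
`U` part (`fixedPointAlgebra_eq`). -/

/-- A pair of elements of a unital star algebra satisfying the Cuntz relations of `O₂`. -/
structure CuntzRel {A : Type*} [Ring A] [StarRing A] (a b : A) : Prop where
  star_mul_left : star a * a = 1
  star_mul_right : star b * b = 1
  sum_eq_one : a * star a + b * star b = 1

/-! ### Spans of words in the generators and their adjoints -/

section Words

variable {A : Type*} [Ring A] [Algebra ℂ A]

/-- The linear span of two elements. -/
abbrev pairSpan (a b : A) : Submodule ℂ A := Submodule.span ℂ {a, b}

theorem left_mem_pairSpan (a b : A) : a ∈ pairSpan a b := Submodule.subset_span (by simp)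

theorem right_mem_pairSpan (a b : A) : b ∈ pairSpan a b := Submodule.subset_span (by simp)

variable [StarRing A] [StarModule ℂ A]

/-- The span of the products `μ ν*` of words `μ`, `ν` in `a`, `b` of lengths `m` and `n`. -/
abbrev wordSpan (a b : A) (m n : ℕ) : Submodule ℂ A :=
  pairSpan a b ^ m * pairSpan (star a) (star b) ^ n

theorem star_mem_pairSpan {a b x : A} (hx : x ∈ pairSpan a b) :
    star x ∈ pairSpan (star a) (star b) := by
  obtain ⟨c, d, rfl⟩ := Submodule.mem_span_pair.1 hx
  simp only [star_add, star_smul]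
  exact Submodule.mem_span_pair.2 ⟨_, _, rfl⟩

theorem star_mem_pairSpan_pow {a b x : A} {n : ℕ} (hx : x ∈ pairSpan a b ^ n) :
    star x ∈ pairSpan (star a) (star b) ^ n := by
  refine Submodule.pow_induction_on_left' (M := pairSpan a b)
    (C := fun n x _ => star x ∈ pairSpan (star a) (star b) ^ n) ?_ ?_ ?_ hx
  · intro r
    rw [← algebraMap_star_comm, pow_zero]
    exact Submodule.algebraMap_mem _
  · intro x y i _ _ hx hy
    rw [star_add]
    exact add_mem hx hy
  · intro m hm i x _ hx
    rw [star_mul, pow_succ]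
    exact Submodule.mul_mem_mul hx (star_mem_pairSpan hm)

theorem star_mem_wordSpan {a b x : A} {m n : ℕ} (hx : x ∈ wordSpan a b m n) :
    star x ∈ wordSpan a b n m := by
  refine Submodule.mul_induction_on hx ?_ ?_
  · intro y hy z hz
    rw [star_mul]
    refine Submodule.mul_mem_mul ?_ (star_mem_pairSpan_pow hy)
    simpa using star_mem_pairSpan_pow hz
  · intro y z hy hz
    rw [star_add]
    exact add_mem hy hz

end Words

/-! ### Cuntz relations and the finite-dimensional subalgebras -/

namespace CuntzRel

section Algebraic

variable {A : Type*} [Ring A] [StarRing A] {a b : A}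

theorem symm (h : CuntzRel a b) : CuntzRel b a :=
  ⟨h.2, h.1, by rw [add_comm]; exact h.3⟩

theorem prod {B : Type*} [Ring B] [StarRing B] {c d : B} (h : CuntzRel a b) (h' : CuntzRel c d) :
    CuntzRel (a, c) (b, d) :=
  ⟨Prod.ext h.1 h'.1, Prod.ext h.2 h'.2, Prod.ext h.3 h'.3⟩

end Algebraic

variable {A : Type*} [CStarAlgebra A] {a b : A}

/-- Compressing the sum relation by `a` gives `1 + (a* b)(a* b)* = 1`. -/
theorem orthogonal (h : CuntzRel a b) : star a * b = 0 := by
  have e : star a * (a * star a + b * star b) * a = 1 := by rw [h.3, mul_one, h.1]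
  have e' : star a * (a * star a + b * star b) * a
      = (star a * a) * (star a * a) + (star a * b) * star (star a * b) := by
    rw [star_mul, star_star]; noncomm_ring
  rw [e', h.1, mul_one, add_eq_left] at e
  exact CStarRing.mul_star_self_eq_zero_iff _ |>.1 e

theorem orthogonal' (h : CuntzRel a b) : star b * a = 0 := h.symm.orthogonal

theorem star_mul_pairSpan (h : CuntzRel a b) :
    pairSpan (star a) (star b) * pairSpan a b ≤ 1 := by
  rw [Submodule.span_mul_span, Submodule.span_le]
  rintro _ ⟨x, hx, y, hy, rfl⟩
  have h1 : (1 : A) ∈ (1 : Submodule ℂ A) := Submodule.one_le.1 le_rfl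
  rcases hx with rfl | rfl <;> rcases hy with rfl | rfl
  · simpa [h.1] using h1
  · simp [h.orthogonal]
  · simp [h.orthogonal']
  · simpa [h.2] using h1

theorem star_mul_pairSpan_pow (h : CuntzRel a b) (n : ℕ) :
    pairSpan (star a) (star b) ^ n * pairSpan a b ^ n ≤ 1 := by
  induction n with
  | zero => simp
  | succ n ih =>
    rw [pow_succ, pow_succ', mul_assoc, ← mul_assoc (pairSpan (star a) (star b))]
    refine (mul_le_mul_right ?_ _).trans ih
    exact (mul_le_mul_left h.star_mul_pairSpan _).trans (one_mul _).le

theorem one_le_pairSpan_mul (h : CuntzRel a b) :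
    1 ≤ pairSpan a b * pairSpan (star a) (star b) := by
  rw [Submodule.one_le, ← h.3]
  exact add_mem (Submodule.mul_mem_mul (left_mem_pairSpan _ _) (left_mem_pairSpan _ _))
    (Submodule.mul_mem_mul (right_mem_pairSpan _ _) (right_mem_pairSpan _ _))

theorem wordSpan_le_succ (h : CuntzRel a b) (m n : ℕ) :
    wordSpan a b m n ≤ wordSpan a b (m + 1) (n + 1) := by
  rw [wordSpan, wordSpan, pow_succ, pow_succ', mul_assoc, ← mul_assoc (pairSpan a b)]
  refine mul_le_mul_right ?_ _
  exact (one_mul _).ge.trans (mul_le_mul_left h.one_le_pairSpan_mul _)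

theorem one_le_wordSpan (h : CuntzRel a b) (n : ℕ) : 1 ≤ wordSpan a b n n := by
  induction n with
  | zero => simp [wordSpan]
  | succ n ih => exact ih.trans (h.wordSpan_le_succ n n)

theorem wordSpan_mul_wordSpan_le (h : CuntzRel a b) (m n p : ℕ) :
    wordSpan a b m n * wordSpan a b n p ≤ wordSpan a b m p := by
  rw [wordSpan, wordSpan, wordSpan, mul_assoc, ← mul_assoc (pairSpan (star a) (star b) ^ n)]
  refine mul_le_mul_right ?_ _
  exact (mul_le_mul_left (h.star_mul_pairSpan_pow n) _).trans (one_mul _).le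

/-- The finite-dimensional subalgebra spanned by the products `μ ν*` with `μ` and `ν` of
length `n`. -/
def matrixSubalgebra (h : CuntzRel a b) (n : ℕ) : StarSubalgebra ℂ A where
  carrier := wordSpan a b n n
  mul_mem' hx hy := h.wordSpan_mul_wordSpan_le n n n (Submodule.mul_mem_mul hx hy)
  one_mem' := Submodule.one_le.1 (h.one_le_wordSpan n)
  add_mem' := add_mem
  zero_mem' := zero_mem _
  algebraMap_mem' r := h.one_le_wordSpan n (Submodule.algebraMap_mem r)
  star_mem' := star_mem_wordSpan

theorem isClosed_matrixSubalgebra (h : CuntzRel a b) (n : ℕ) :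
    IsClosed (h.matrixSubalgebra n : Set A) := by
  have hfg (c d : A) : (pairSpan c d).FG := Submodule.fg_span (by simp)
  have : (wordSpan a b n n).FG := ((hfg _ _).pow n).mul ((hfg _ _).pow n)
  have : FiniteDimensional ℂ (wordSpan a b n n) := Module.Finite.iff_fg.2 this
  exact (wordSpan a b n n).closed_of_finiteDimensional

variable {B : Type*} [CStarAlgebra B] [Nontrivial B]

/-- For words `μ`, `ν` of length `n`, `μ* x ν` is a scalar, and `π` is injective on scalars because
`B` is nontrivial. So all these compressions vanish, and inserting `1 ∈ V ^ n * W ^ n` on both sides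
of `x` gives `x = 0`. -/
theorem eq_zero_of_mem_wordSpan (h : CuntzRel a b) (π : A →⋆ₐ[ℂ] B) {n : ℕ} {x : A}
    (hx : x ∈ wordSpan a b n n) (hπ : π x = 0) : x = 0 := by
  set V := pairSpan a b
  set W := pairSpan (star a) (star b)
  have key : W ^ n * Submodule.span ℂ {x} * V ^ n = ⊥ := by
    rw [eq_bot_iff, Submodule.mul_le]
    intro y hy v hv
    obtain ⟨w, hw, rfl⟩ := Submodule.mem_mul_span_singleton.1 hy
    have hmem : w * x * v ∈ (1 : Submodule ℂ A) := by
      have : w * x * v ∈ W ^ n * (V ^ n * W ^ n) * V ^ n :=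
        Submodule.mul_mem_mul (Submodule.mul_mem_mul hw hx) hv
      rw [← mul_assoc, mul_assoc] at this
      exact ((mul_le_mul' (h.star_mul_pairSpan_pow n) (h.star_mul_pairSpan_pow n)).trans
        (one_mul _).le) this
    obtain ⟨c, hc⟩ := Submodule.mem_one.1 hmem
    have h0 : π (w * x * v) = 0 := by simp [hπ]
    rw [← hc, AlgHomClass.commutes, map_eq_zero_iff _ (algebraMap ℂ B).injective] at h0
    rw [← hc, h0, map_zero]
    exact zero_mem _
  have hle : Submodule.span ℂ {x} ≤ V ^ n * W ^ n * Submodule.span ℂ {x} * (V ^ n * W ^ n) := by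
    calc Submodule.span ℂ {x} = 1 * Submodule.span ℂ {x} * 1 := by rw [one_mul, mul_one]
      _ ≤ _ := mul_le_mul' (mul_le_mul_left (h.one_le_wordSpan n) _) (h.one_le_wordSpan n)
  have e : V ^ n * W ^ n * Submodule.span ℂ {x} * (V ^ n * W ^ n)
      = V ^ n * (W ^ n * Submodule.span ℂ {x} * V ^ n) * W ^ n := by simp only [mul_assoc]
  rw [e, key, Submodule.mul_bot, Submodule.bot_mul, le_bot_iff, Submodule.span_singleton_eq_bot]
    at hle
  exact hle

theorem norm_map_of_mem_wordSpan_self (h : CuntzRel a b) (π : A →⋆ₐ[ℂ] B) {n : ℕ} {x : A}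
    (hx : x ∈ wordSpan a b n n) : ‖π x‖ = ‖x‖ := by
  have := h.isClosed_matrixSubalgebra n
  refine NonUnitalStarAlgHom.norm_map (π.comp (h.matrixSubalgebra n).subtype) ?_
    (⟨x, hx⟩ : h.matrixSubalgebra n)
  rw [injective_iff_map_eq_zero]
  exact fun y hy => Subtype.ext (h.eq_zero_of_mem_wordSpan π y.2 hy)

theorem norm_map_of_mem_wordSpan (h : CuntzRel a b) (π : A →⋆ₐ[ℂ] B) {m n : ℕ} {x : A}
    (hx : x ∈ wordSpan a b m n) : ‖π x‖ = ‖x‖ := by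
  have : star x * x ∈ wordSpan a b n n :=
    h.wordSpan_mul_wordSpan_le n m n (Submodule.mul_mem_mul (star_mem_wordSpan hx) hx)
  have := h.norm_map_of_mem_wordSpan_self π this
  rw [map_mul, map_star, CStarRing.norm_star_mul_self, CStarRing.norm_star_mul_self] at this
  exact (mul_self_inj (norm_nonneg _) (norm_nonneg _)).1 this

/-! ### The canonical endomorphism and isometries with orthogonal ranges -/

/-- The canonical endomorphism `y ↦ a y a* + b y b*`. -/
def shift (h : CuntzRel a b) : A →⋆ₐ[ℂ] A where
  toFun y := a * y * star a + b * y * star b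
  map_one' := by rw [mul_one, mul_one, h.3]
  map_mul' x y := by
    have : (a * x * star a + b * x * star b) * (a * y * star a + b * y * star b)
        = a * x * (star a * a) * y * star a + a * x * (star a * b) * y * star b
          + b * x * (star b * a) * y * star a + b * x * (star b * b) * y * star b := by
      noncomm_ring
    rw [this, h.1, h.2, h.orthogonal, h.orthogonal']
    simp [mul_assoc]
  map_zero' := by simp
  map_add' x y := by noncomm_ring
  commutes' r := by
    rw [← Algebra.commutes r a, ← Algebra.commutes r b, mul_assoc, mul_assoc, ← mul_add, h.3,
      mul_one]
  map_star' x := by simp [mul_assoc]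

theorem shift_apply (h : CuntzRel a b) (y : A) :
    h.shift y = a * y * star a + b * y * star b := rfl

theorem shift_mul_of_mem (h : CuntzRel a b) (y : A) {x : A} (hx : x ∈ pairSpan a b) :
    h.shift y * x = x * y := by
  obtain ⟨c, d, rfl⟩ := Submodule.mem_span_pair.1 hx
  simp [shift_apply, mul_add, add_mul, mul_assoc, h.1, h.2, h.orthogonal, h.orthogonal']

theorem shift_pow_mul_of_mem (h : CuntzRel a b) (y : A) {x : A} {n : ℕ}
    (hx : x ∈ pairSpan a b ^ n) : (h.shift ^ n) y * x = x * y := by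
  refine Submodule.pow_induction_on_left' (M := pairSpan a b)
    (C := fun n x _ => (h.shift ^ n) y * x = x * y) ?_ ?_ ?_ hx
  · intro r
    exact (Algebra.commutes r y).symm
  · intro x z i _ _ hx hz
    rw [mul_add, hx, hz, add_mul]
  · intro m hm i x _ hx
    have : (h.shift ^ i.succ) y = h.shift ((h.shift ^ i) y) := by rw [pow_succ']; rfl
    rw [this, ← mul_assoc, h.shift_mul_of_mem _ hm, mul_assoc, hx, mul_assoc]

theorem mul_shift_pow_of_mem (h : CuntzRel a b) (y : A) {x : A} {n : ℕ}
    (hx : x ∈ pairSpan (star a) (star b) ^ n) : x * (h.shift ^ n) y = y * x := by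
  have hx' : star x ∈ pairSpan a b ^ n := by simpa using star_mem_pairSpan_pow hx
  simpa [← map_star] using congrArg star (h.shift_pow_mul_of_mem (star y) hx')

/-- Moving an element across `μ ν*` changes its power of the shift by the degree of `μ ν*`; this is
what distinguishes homogeneous parts. -/
theorem shift_pow_mul_of_mem_wordSpan (h : CuntzRel a b) (y : A) {x : A} {m n : ℕ}
    (hx : x ∈ wordSpan a b m n) : (h.shift ^ m) y * x = x * (h.shift ^ n) y := by
  refine Submodule.mul_induction_on hx ?_ ?_
  · intro v hv w hw
    rw [← mul_assoc, h.shift_pow_mul_of_mem y hv, mul_assoc, mul_assoc,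
      h.mul_shift_pow_of_mem y hw]
  · intro v w hv hw
    rw [mul_add, hv, hw, add_mul]

theorem star_pow_mul_pow (h : CuntzRel a b) (n : ℕ) : star a ^ n * a ^ n = 1 := by
  induction n with
  | zero => simp
  | succ n ih => rw [pow_succ, pow_succ', mul_assoc, ← mul_assoc (star a), h.1, one_mul, ih]

theorem star_mul_self_pow_mul (h : CuntzRel a b) (n : ℕ) :
    star (a ^ n * b) * (a ^ n * b) = 1 := by
  rw [star_mul, star_pow, mul_assoc, ← mul_assoc (star a ^ n), h.star_pow_mul_pow, one_mul, h.2]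

/-- Since `a*^j` turns the shifted factor into `u a*^j`, cancelling the remaining `a*^(n-j)` leaves
`b*` directly against one of the `j > 0` surviving letters `a`. -/
theorem star_mul_shift_pow (h : CuntzRel a b) {n j : ℕ} (hj : 0 < j) (hjn : j ≤ n) :
    star (a ^ n * b) * (h.shift ^ j) (a ^ n * b) = 0 := by
  obtain ⟨k, rfl⟩ := Nat.exists_eq_add_of_le' hjn
  obtain ⟨i, rfl⟩ := Nat.exists_eq_succ_of_ne_zero hj.ne'
  set u := a ^ (k + i.succ) * b
  have hmem : star a ^ i.succ ∈ pairSpan (star a) (star b) ^ i.succ :=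
    Submodule.pow_mem_pow _ (left_mem_pairSpan _ _) _
  calc star u * (h.shift ^ i.succ) u
      = star b * star a ^ k * (star a ^ i.succ * (h.shift ^ i.succ) u) := by
        have e : star u = star b * star a ^ k * star a ^ i.succ := by
          rw [star_mul, star_pow, pow_add, mul_assoc]
        rw [e, mul_assoc]
    _ = star b * ((star a ^ k * a ^ k) * a ^ i.succ * b * star a ^ i.succ) := by
        rw [h.mul_shift_pow_of_mem u hmem]
        simp only [u, pow_add, mul_assoc]
    _ = (star b * a) * a ^ i * b * star a ^ i.succ := by
        rw [h.star_pow_mul_pow, one_mul, pow_succ' a]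
        simp only [mul_assoc]
    _ = 0 := by rw [h.orthogonal']; simp

theorem star_shift_pow_mul_shift_pow (h : CuntzRel a b) {n i j : ℕ} (hi : i ≤ n) (hj : j ≤ n) :
    star ((h.shift ^ i) (a ^ n * b)) * (h.shift ^ j) (a ^ n * b) = if i = j then 1 else 0 := by
  wlog hij : i ≤ j generalizing i j
  · have := congrArg star (this hj hi (by omega))
    rw [star_mul, star_star] at this
    rw [this]
    split_ifs with h1 h2 h2 <;> first | omega | simp
  obtain ⟨k, rfl⟩ := Nat.exists_eq_add_of_le hij
  have e : (h.shift ^ (i + k)) (a ^ n * b) = (h.shift ^ i) ((h.shift ^ k) (a ^ n * b)) := by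
    rw [pow_add]; rfl
  rw [e, ← map_star, ← map_mul]
  rcases Nat.eq_zero_or_pos k with rfl | hk
  · have e0 : (h.shift ^ 0) (a ^ n * b) = a ^ n * b := rfl
    rw [e0, h.star_mul_self_pow_mul, map_one, if_pos (by omega)]
  · rw [h.star_mul_shift_pow hk (by omega), map_zero, if_neg (by omega)]

end CuntzRel

/-! ### Homogeneous decomposition and the norm estimate -/

/-- The span of `1` and the two elements together with their adjoints. -/
abbrev letterSpan {A : Type*} [Ring A] [Algebra ℂ A] [StarRing A] (a b : A) : Submodule ℂ A :=
  pairSpan a b ⊔ pairSpan (star a) (star b) ⊔ 1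

theorem star_mem_letterSpan_pow {A : Type*} [Ring A] [Algebra ℂ A] [StarRing A] [StarModule ℂ A]
    {a b x : A} {n : ℕ} (hx : x ∈ letterSpan a b ^ n) : star x ∈ letterSpan a b ^ n := by
  have key : ∀ m ∈ letterSpan a b, star m ∈ letterSpan a b := by
    intro m hm
    obtain ⟨y, hy, c, hc, rfl⟩ := Submodule.mem_sup.1 hm
    obtain ⟨v, hv, w, hw, rfl⟩ := Submodule.mem_sup.1 hy
    obtain ⟨r, rfl⟩ := Submodule.mem_one.1 hc
    rw [star_add, star_add, ← algebraMap_star_comm, add_comm (star v)]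
    refine Submodule.add_mem_sup (Submodule.add_mem_sup ?_ (star_mem_pairSpan hv))
      (Submodule.algebraMap_mem _)
    simpa using star_mem_pairSpan hw
  refine Submodule.pow_induction_on_left' (M := letterSpan a b)
    (C := fun n x _ => star x ∈ letterSpan a b ^ n) ?_ ?_ ?_ hx
  · intro r
    rw [← algebraMap_star_comm, pow_zero]
    exact Submodule.algebraMap_mem _
  · intro x y i _ _ hx hy
    rw [star_add]
    exact add_mem hx hy
  · intro m hm i x _ hx
    rw [star_mul, pow_succ]
    exact Submodule.mul_mem_mul hx (key m hm)

theorem exists_mem_letterSpan_pow {A : Type*} [Ring A] [Algebra ℂ A] [StarRing A] [StarModule ℂ A]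
    {a b x : A} (hx : x ∈ StarAlgebra.adjoin ℂ {a, b}) : ∃ n, x ∈ letterSpan a b ^ n := by
  have hmono : Monotone (letterSpan a b ^ ·) := fun m n hmn =>
    pow_le_pow_right' le_sup_right hmn
  have hle : pairSpan a b ≤ letterSpan a b := le_sup_left.trans le_sup_left
  induction hx using StarAlgebra.adjoin_induction with
  | mem x hx =>
    refine ⟨1, ?_⟩
    rw [pow_one]
    exact hle (Submodule.subset_span hx)
  | algebraMap r => exact ⟨0, by rw [pow_zero]; exact Submodule.algebraMap_mem r⟩
  | add x y _ _ hx hy =>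
    obtain ⟨m, hm⟩ := hx
    obtain ⟨n, hn⟩ := hy
    exact ⟨max m n, add_mem (hmono (le_max_left m n) hm) (hmono (le_max_right m n) hn)⟩
  | mul x y _ _ hx hy =>
    obtain ⟨m, hm⟩ := hx
    obtain ⟨n, hn⟩ := hy
    exact ⟨m + n, by rw [pow_add]; exact Submodule.mul_mem_mul hm hn⟩
  | star x _ hx =>
    obtain ⟨m, hm⟩ := hx
    exact ⟨m, star_mem_letterSpan_pow hm⟩

/-- If `t ^ n ≤ (c n + 1) s ^ n` along the powers `n` of `2`, then `t ≤ s`. -/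
theorem le_of_pow_two_pow_le {s t c : ℝ} (hs : 0 ≤ s)
    (h : ∀ k : ℕ, t ^ 2 ^ k ≤ (c * (2 ^ k : ℕ) + 1) * s ^ 2 ^ k) : t ≤ s := by
  by_contra! hst
  have ht : 0 < t := hs.trans_lt hst
  have hr0 : 0 ≤ s / t := by positivity
  have hr1 : s / t < 1 := (div_lt_one ht).2 hst
  have l1 : Filter.Tendsto (fun n : ℕ => (c * n + 1) * (s / t) ^ n) Filter.atTop (nhds 0) := by
    have := ((tendsto_self_mul_const_pow_of_lt_one hr0 hr1).const_mul c).add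
      (tendsto_pow_atTop_nhds_zero_of_lt_one hr0 hr1)
    rw [mul_zero, add_zero] at this
    refine this.congr fun n => ?_
    ring
  have l2 := l1.comp (tendsto_pow_atTop_atTop_of_one_lt one_lt_two)
  -- The hypothesis keeps this null sequence at least `1`.
  refine absurd (ge_of_tendsto' l2 fun k => ?_) (not_le.2 one_pos)
  have := h k
  simp only [Function.comp_apply]
  rw [div_pow, ← mul_div_assoc, le_div_iff₀ (by positivity), one_mul]
  exact this

namespace CuntzRel

variable {A : Type*} [CStarAlgebra A] {a b : A}

/-- Padding with `1 = a a* + b b*` lengthens both words at once, so every term can be given exactly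
`n` adjoint letters; `j` then encodes the degree `j - n`, between `-n` and `n`. -/
theorem letterSpan_pow_le (h : CuntzRel a b) (n : ℕ) :
    letterSpan a b ^ n ≤ ⨆ j ∈ Finset.range (2 * n + 1), wordSpan a b j n := by
  induction n with
  | zero => simp [wordSpan]
  | succ n ih =>
    rw [pow_succ']
    refine (mul_le_mul_right ih _).trans ?_
    simp only [Submodule.mul_iSup]
    refine iSup₂_le fun j hj => ?_
    have hj' := Finset.mem_range.1 hj
    have hmem (i : ℕ) (hi : i < 2 * (n + 1) + 1) : wordSpan a b i (n + 1) ≤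
        ⨆ j ∈ Finset.range (2 * (n + 1) + 1), wordSpan a b j (n + 1) :=
      le_iSup₂_of_le i (Finset.mem_range.2 hi) le_rfl
    rw [Submodule.sup_mul, Submodule.sup_mul, one_mul]
    refine sup_le (sup_le ?_ ?_) ?_
    · rw [wordSpan, ← mul_assoc, ← pow_succ']
      exact (h.wordSpan_le_succ (j + 1) n).trans (hmem _ (by omega))
    -- An adjoint letter cancels against a leading plain letter; if there is none, it joins the
    -- adjoint word.
    · rcases j with _ | j
      · rw [wordSpan, pow_zero, one_mul, ← pow_succ']
        refine le_trans ?_ (hmem 0 (by omega))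
        rw [wordSpan, pow_zero, one_mul]
      · refine le_trans ?_ ((h.wordSpan_le_succ j n).trans (hmem (j + 1) (by omega)))
        rw [wordSpan, pow_succ', ← mul_assoc, ← mul_assoc]
        refine mul_le_mul_left ?_ _
        exact (mul_le_mul_left h.star_mul_pairSpan _).trans (one_mul _).le
    · exact (h.wordSpan_le_succ j n).trans (hmem (j + 1) (by omega))

theorem norm_le_of_star_mul_self {x : A} (hx : star x * x = 1) : ‖x‖ ≤ 1 := by
  rcases subsingleton_or_nontrivial A with _ | _
  · rw [Subsingleton.elim x 0, norm_zero]; exact zero_le_one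
  · have := CStarRing.norm_star_mul_self (x := x)
    rw [hx, CStarRing.norm_one] at this
    nlinarith

variable {B : Type*} [CStarAlgebra B] [Nontrivial B]

theorem norm_le_mul_norm_map (h : CuntzRel a b) (π : A →⋆ₐ[ℂ] B) {n : ℕ} {y : A}
    (hy : y ∈ letterSpan a b ^ n) : ‖y‖ ≤ (2 * n + 1) * ‖π y‖ := by
  obtain ⟨f, hf⟩ := (Submodule.mem_iSup_finset_iff_exists_sum _ _).1 (h.letterSpan_pow_le n hy)
  -- The exponent `2 * n` makes `v 0, …, v (2n)` have mutually orthogonal ranges, one for each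
  -- degree.
  set v : ℕ → A := fun j => (h.shift ^ j) (a ^ (2 * n) * b)
  have hv (i j : ℕ) (hi : i ≤ 2 * n) (hj : j ≤ 2 * n) :
      star (v i) * v j = if i = j then 1 else 0 := h.star_shift_pow_mul_shift_pow hi hj
  have hv1 (i : ℕ) (hi : i ≤ 2 * n) : ‖π (v i)‖ ≤ 1 := by
    refine norm_le_of_star_mul_self ?_
    rw [← map_star, ← map_mul, hv i i hi hi, if_pos rfl, map_one]
  -- All parts have `n` adjoint letters, so `f i * v n = v i * f i`, and `star (v j)` selects `i =
  -- j`.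
  have hcomp (j : ℕ) (hj : j ∈ Finset.range (2 * n + 1)) : (f j : A) = star (v j) * y * v n := by
    have hj' : j ≤ 2 * n := by have := Finset.mem_range.1 hj; omega
    rw [← hf, Finset.mul_sum, Finset.sum_mul, Finset.sum_eq_single_of_mem j hj]
    · rw [mul_assoc, ← h.shift_pow_mul_of_mem_wordSpan _ (f j).2, ← mul_assoc, hv j j hj' hj',
        if_pos rfl, one_mul]
    · intro i hi hij
      rw [mul_assoc, ← h.shift_pow_mul_of_mem_wordSpan _ (f i).2, ← mul_assoc,
        hv j i hj' (by have := Finset.mem_range.1 hi; omega), if_neg hij.symm, zero_mul]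
  have hbound (j : ℕ) (hj : j ∈ Finset.range (2 * n + 1)) : ‖(f j : A)‖ ≤ ‖π y‖ := by
    have hj' : j ≤ 2 * n := by have := Finset.mem_range.1 hj; omega
    rw [← h.norm_map_of_mem_wordSpan π (f j).2, hcomp j hj, map_mul, map_mul, map_star]
    calc ‖star (π (v j)) * π y * π (v n)‖ ≤ ‖star (π (v j))‖ * ‖π y‖ * ‖π (v n)‖ :=
          norm_mul₃_le
      _ ≤ 1 * ‖π y‖ * 1 := by
          rw [norm_star]
          gcongr
          · exact hv1 j hj'
          · exact hv1 n (by omega)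
      _ = ‖π y‖ := by ring
  calc ‖y‖ = ‖∑ j ∈ Finset.range (2 * n + 1), (f j : A)‖ := by rw [hf]
    _ ≤ ∑ j ∈ Finset.range (2 * n + 1), ‖π y‖ := norm_sum_le_of_le _ hbound
    _ = (2 * n + 1) * ‖π y‖ := by simp

/-- For self-adjoint elements the norm of a `2 ^ k`-th power is the power of the norm, while the
loss factor grows only linearly in `2 ^ k`. -/
theorem norm_le_norm_map_of_mem_adjoin (h : CuntzRel a b) (π : A →⋆ₐ[ℂ] B) {x : A}
    (hx : x ∈ StarAlgebra.adjoin ℂ {a, b}) : ‖x‖ ≤ ‖π x‖ := by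
  obtain ⟨r, hr⟩ := exists_mem_letterSpan_pow hx
  have hmem : star x * x ∈ letterSpan a b ^ (r + r) := by
    rw [pow_add]
    exact Submodule.mul_mem_mul (star_mem_letterSpan_pow hr) hr
  have hsa : IsSelfAdjoint (star x * x) := IsSelfAdjoint.star_mul_self x
  have hsa' : IsSelfAdjoint (π (star x * x)) := hsa.map π
  have : ‖star x * x‖ ≤ ‖π (star x * x)‖ := by
    refine le_of_pow_two_pow_le (c := 2 * (r + r)) (norm_nonneg _) fun k => ?_
    have hmem' : (star x * x) ^ 2 ^ k ∈ letterSpan a b ^ ((r + r) * 2 ^ k) := by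
      rw [pow_mul]
      exact Submodule.pow_mem_pow _ hmem _
    have := h.norm_le_mul_norm_map π hmem'
    rw [map_pow, hsa.norm_pow_two_pow, hsa'.norm_pow_two_pow] at this
    push_cast at this ⊢
    rwa [mul_assoc]
  rw [map_mul, map_star, CStarRing.norm_star_mul_self, CStarRing.norm_star_mul_self] at this
  exact (mul_self_le_mul_self_iff (norm_nonneg _) (norm_nonneg _)).2 this

end CuntzRel

/-! ### C*-algebras generated by two elements -/

section Generated

variable {A : Type*} [CStarAlgebra A]

theorem isClosed_cstarGen (a b : A) : IsClosed (cstarGen a b : Set A) :=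
  StarSubalgebra.isClosed_topologicalClosure _

theorem cstarGen_le {a b : A} {S : StarSubalgebra ℂ A} (hS : IsClosed (S : Set A)) (ha : a ∈ S)
    (hb : b ∈ S) : cstarGen a b ≤ S :=
  StarSubalgebra.topologicalClosure_minimal
    (StarAlgebra.adjoin_le (by rintro _ (rfl | rfl) <;> assumption)) hS

theorem StarAlgHom.continuous_of_cstarAlgebra {B : Type*} [CStarAlgebra B] (π : A →⋆ₐ[ℂ] B) :
    Continuous π :=
  AddMonoidHomClass.continuous_of_bound π 1
    (by simpa only [one_mul] using NonUnitalStarAlgHom.norm_apply_le π)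

theorem cstarGen_fst_snd_eq_top (a b : A) :
    cstarGen (cstarGen.fst a b) (cstarGen.snd a b) = ⊤ := by
  rw [eq_top_iff]
  intro x _
  have himage : Subtype.val '' (StarAlgebra.adjoin ℂ {cstarGen.fst a b, cstarGen.snd a b} :
      Set (cstarGen a b)) = (StarAlgebra.adjoin ℂ {a, b} : Set A) := by
    have := StarAlgHom.map_adjoin (cstarGen a b).subtype {cstarGen.fst a b, cstarGen.snd a b}
    rw [Set.image_pair] at this
    exact congrArg (fun S : StarSubalgebra ℂ A => (S : Set A)) this
  change x ∈ closure (StarAlgebra.adjoin ℂ {cstarGen.fst a b, cstarGen.snd a b} :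
    Set (cstarGen a b))
  rw [closure_subtype, himage]
  exact x.2

/-- Homomorphisms on a C*-algebra generated by two elements are determined by these. -/
theorem StarAlgHom.ext_of_cstarGen_eq_top {B : Type*} [CStarAlgebra B] {a b : A}
    (h : cstarGen a b = ⊤) {f g : A →⋆ₐ[ℂ] B} (ha : f a = g a) (hb : f b = g b) : f = g := by
  have hle : cstarGen a b ≤ StarAlgHom.equalizer f g :=
    cstarGen_le (isClosed_eq f.continuous_of_cstarAlgebra g.continuous_of_cstarAlgebra) ha hb
  ext x
  exact hle (h ▸ trivial)

end Generated

/-! ### Uniqueness of `O₂` and the swap automorphism -/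

namespace CuntzRel

variable {A : Type*} [CStarAlgebra A] {a b : A} {B : Type*} [CStarAlgebra B]

theorem norm_map_of_mem_cstarGen [Nontrivial B] (h : CuntzRel a b) (π : A →⋆ₐ[ℂ] B) {x : A}
    (hx : x ∈ cstarGen a b) : ‖π x‖ = ‖x‖ := by
  refine le_antisymm (NonUnitalStarAlgHom.norm_apply_le π x) ?_
  have hcl : IsClosed {y : A | ‖y‖ ≤ ‖π y‖} :=
    isClosed_le continuous_norm π.continuous_of_cstarAlgebra.norm
  exact closure_minimal (fun y hy => h.norm_le_norm_map_of_mem_adjoin π hy) hcl hx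

theorem exists_equiv_map [Nontrivial B] (h : CuntzRel a b) (π : A →⋆ₐ[ℂ] B) :
    ∃ e : cstarGen a b ≃⋆ₐ[ℂ] cstarGen (π a) (π b), ∀ x, (e x : B) = π x := by
  have hmem (x : cstarGen a b) : π x ∈ cstarGen (π a) (π b) := by
    have : cstarGen a b ≤ (cstarGen (π a) (π b)).comap π :=
      cstarGen_le ((isClosed_cstarGen _ _).preimage π.continuous_of_cstarAlgebra)
        (left_mem_cstarGen _ _) (right_mem_cstarGen _ _)
    exact this x.2
  have := isClosed_cstarGen a b
  let ρ : cstarGen a b →⋆ₐ[ℂ] B := π.comp (cstarGen a b).subtype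
  -- An isometry from a complete space has closed range, so the range contains the whole generated
  -- C*-algebra.
  have hρ : Isometry ρ :=
    AddMonoidHomClass.isometry_of_norm ρ fun x => h.norm_map_of_mem_cstarGen π x.2
  have hle : cstarGen (π a) (π b) ≤ ρ.range :=
    cstarGen_le hρ.isClosedEmbedding.isClosed_range ⟨cstarGen.fst a b, rfl⟩
      ⟨cstarGen.snd a b, rfl⟩
  refine ⟨StarAlgEquiv.ofBijective (ρ.codRestrict (cstarGen (π a) (π b)) hmem) ⟨?_, ?_⟩,
    fun _ => rfl⟩
  · exact fun x y hxy => hρ.injective (congrArg Subtype.val hxy)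
  · intro y
    obtain ⟨x, hx⟩ := hle y.2
    exact ⟨x, Subtype.ext hx⟩

/-- Cuntz's theorem for `O₂`: the C*-algebra generated by a pair satisfying the Cuntz relations
does not depend on the pair. -/
theorem exists_equiv [Nontrivial A] [Nontrivial B] (h : CuntzRel a b) {c d : B}
    (h' : CuntzRel c d) : ∃ e : cstarGen a b ≃⋆ₐ[ℂ] cstarGen c d,
      e (cstarGen.fst a b) = cstarGen.fst c d ∧ e (cstarGen.snd a b) = cstarGen.snd c d := by
  obtain ⟨e₁, he₁⟩ := (h.prod h').exists_equiv_map (StarAlgHom.fst ℂ A B)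
  obtain ⟨e₂, he₂⟩ := (h.prod h').exists_equiv_map (StarAlgHom.snd ℂ A B)
  have e₁f : e₁.symm (cstarGen.fst a b) = cstarGen.fst (a, c) (b, d) :=
    e₁.symm_apply_eq.2 (Subtype.ext (he₁ (cstarGen.fst (a, c) (b, d))).symm)
  have e₁s : e₁.symm (cstarGen.snd a b) = cstarGen.snd (a, c) (b, d) :=
    e₁.symm_apply_eq.2 (Subtype.ext (he₁ (cstarGen.snd (a, c) (b, d))).symm)
  refine ⟨e₁.symm.trans e₂, ?_, ?_⟩
  · exact (congrArg e₂ e₁f).trans (Subtype.ext (he₂ _))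
  · exact (congrArg e₂ e₁s).trans (Subtype.ext (he₂ _))

theorem left_ne_right [Nontrivial A] (h : CuntzRel a b) : a ≠ b := by
  rintro rfl
  exact one_ne_zero (h.1.symm.trans h.orthogonal)

theorem cstarGen_swap (a b : A) : cstarGen a b = cstarGen b a := by
  rw [cstarGen, cstarGen, Set.pair_comm]

theorem fst_snd (h : CuntzRel a b) : CuntzRel (cstarGen.fst a b) (cstarGen.snd a b) :=
  ⟨Subtype.ext h.1, Subtype.ext h.2, Subtype.ext h.3⟩

theorem starAlgEquiv_ext {f g : cstarGen a b ≃⋆ₐ[ℂ] cstarGen a b}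
    (ha : f (cstarGen.fst a b) = g (cstarGen.fst a b))
    (hb : f (cstarGen.snd a b) = g (cstarGen.snd a b)) : f = g := by
  have := isClosed_cstarGen a b
  have := StarAlgHom.ext_of_cstarGen_eq_top (cstarGen_fst_snd_eq_top a b)
    (f := (f : cstarGen a b →⋆ₐ[ℂ] cstarGen a b)) (g := (g : cstarGen a b →⋆ₐ[ℂ] cstarGen a b))
    ha hb
  ext x
  exact congrArg Subtype.val (DFunLike.congr_fun this x)

theorem apply_snd_of_orderOf {σ : cstarGen a b ≃⋆ₐ[ℂ] cstarGen a b} (hσ : orderOf σ = 2)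
    (h1 : σ (cstarGen.fst a b) = cstarGen.snd a b) :
    σ (cstarGen.snd a b) = cstarGen.fst a b := by
  have : σ ^ 2 = 1 := hσ ▸ pow_orderOf_eq_one σ
  rw [pow_two] at this
  rw [← h1]
  exact DFunLike.congr_fun this (cstarGen.fst a b)

theorem existsUnique_swap [Nontrivial A] (h : CuntzRel a b) :
    ∃! σ : cstarGen a b ≃⋆ₐ[ℂ] cstarGen a b,
      orderOf σ = 2 ∧ σ (cstarGen.fst a b) = cstarGen.snd a b := by
  obtain ⟨e, he₁, he₂⟩ : ∃ e : cstarGen a b ≃⋆ₐ[ℂ] cstarGen a b,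
      e (cstarGen.fst a b) = cstarGen.snd a b ∧ e (cstarGen.snd a b) = cstarGen.fst a b := by
    -- The target is generalised to `S` so that the equality of the two generated algebras can be
    -- substituted without transporting elements.
    have key : ∀ S : StarSubalgebra ℂ A, S = cstarGen b a → ∃ e : cstarGen a b ≃⋆ₐ[ℂ] S,
        (e (cstarGen.fst a b) : A) = b ∧ (e (cstarGen.snd a b) : A) = a := by
      rintro _ rfl
      obtain ⟨e, he₁, he₂⟩ := h.exists_equiv h.symm
      exact ⟨e, congrArg Subtype.val he₁, congrArg Subtype.val he₂⟩
    obtain ⟨e, he₁, he₂⟩ := key _ (cstarGen_swap a b)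
    exact ⟨e, Subtype.ext he₁, Subtype.ext he₂⟩
  refine ⟨e, ⟨orderOf_eq_prime ?_ ?_, he₁⟩, ?_⟩
  · rw [pow_two]
    refine starAlgEquiv_ext ?_ ?_
    · exact (congrArg e he₁).trans he₂
    · exact (congrArg e he₂).trans he₁
  · rintro rfl
    exact h.left_ne_right (congrArg Subtype.val he₁)
  · rintro τ ⟨hτ, hτ₁⟩
    exact starAlgEquiv_ext (hτ₁.trans he₁.symm) ((apply_snd_of_orderOf hτ hτ₁).trans he₂.symm)

end CuntzRel

/-! ### The symmetry `U` and the fixed-point algebra -/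

theorem inv_sqrt_two_mul_self :
    ((1 / Real.sqrt 2 : ℝ) : ℂ) * ((1 / Real.sqrt 2 : ℝ) : ℂ) = 1 / 2 := by
  rw [← Complex.ofReal_mul, div_mul_div_comm, Real.mul_self_sqrt (by norm_num)]
  norm_num

theorem star_inv_sqrt_two :
    star ((1 / Real.sqrt 2 : ℝ) : ℂ) = ((1 / Real.sqrt 2 : ℝ) : ℂ) :=
  Complex.conj_ofReal _

/-- Conjugation by a self-adjoint unitary. -/
def StarAlgHom.conjSymmetry {A : Type*} [Ring A] [Algebra ℂ A] [StarRing A] (u : A)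
    (hu : u * u = 1) (hs : star u = u) : A →⋆ₐ[ℂ] A where
  toFun x := u * x * u
  map_one' := by rw [mul_one, hu]
  map_mul' x y := by
    have : u * x * u * (u * y * u) = u * x * (u * u) * y * u := by noncomm_ring
    rw [this, hu]
    noncomm_ring
  map_zero' := by simp
  map_add' x y := by noncomm_ring
  commutes' r := by rw [← Algebra.commutes r u, mul_assoc, hu, mul_one]
  map_star' x := by simp [hs, mul_assoc]

/-- The sums `b + c u` with `b`, `c` in a subalgebra that is invariant under conjugation by the
self-adjoint unitary `u`. -/
def StarSubalgebra.adjoinSymmetry {A : Type*} [Ring A] [Algebra ℂ A] [StarRing A] [StarModule ℂ A]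
    (S : StarSubalgebra ℂ A) (u : A) (hu : u * u = 1) (hs : star u = u)
    (hS : ∀ x ∈ S, u * x * u ∈ S) : StarSubalgebra ℂ A where
  carrier := {x | ∃ y ∈ S, ∃ z ∈ S, x = y + z * u}
  mul_mem' := by
    rintro _ _ ⟨y, hy, z, hz, rfl⟩ ⟨y', hy', z', hz', rfl⟩
    refine ⟨y * y' + z * (u * z' * u), add_mem (mul_mem hy hy') (mul_mem hz (hS _ hz')),
      y * z' + z * (u * y' * u), add_mem (mul_mem hy hz') (mul_mem hz (hS _ hy')), ?_⟩
    have : z * (u * y' * u) * u = z * u * y' := by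
      rw [← mul_one (z * u * y'), ← hu]
      noncomm_ring
    rw [add_mul _ _ u, this]
    noncomm_ring
  one_mem' := ⟨1, one_mem S, 0, zero_mem S, by simp⟩
  add_mem' := by
    rintro _ _ ⟨y, hy, z, hz, rfl⟩ ⟨y', hy', z', hz', rfl⟩
    exact ⟨y + y', add_mem hy hy', z + z', add_mem hz hz', by noncomm_ring⟩
  zero_mem' := ⟨0, zero_mem S, 0, zero_mem S, by simp⟩
  algebraMap_mem' r := ⟨algebraMap ℂ A r, algebraMap_mem S r, 0, zero_mem S, by simp⟩
  star_mem' := by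
    rintro _ ⟨y, hy, z, hz, rfl⟩
    refine ⟨star y, star_mem hy, u * star z * u, hS _ (star_mem hz), ?_⟩
    rw [star_add, star_mul, hs, mul_assoc (u * star z), hu, mul_one]

namespace CuntzRel

variable {A : Type*} [CStarAlgebra A] {a b : A}

theorem symmetry_mul_left (h : CuntzRel a b) : (a * star a - b * star b) * a = a := by
  rw [sub_mul, mul_assoc, mul_assoc, h.1, h.orthogonal', mul_one, mul_zero, sub_zero]

theorem symmetry_mul_right (h : CuntzRel a b) : (a * star a - b * star b) * b = -b := by
  rw [sub_mul, mul_assoc, mul_assoc, h.2, h.orthogonal, mul_one, mul_zero, zero_sub]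

theorem symmetry_mul_self (h : CuntzRel a b) :
    (a * star a - b * star b) * (a * star a - b * star b) = 1 := by
  rw [mul_sub, ← mul_assoc, ← mul_assoc, h.symmetry_mul_left, h.symmetry_mul_right, neg_mul,
    sub_neg_eq_add, h.3]

theorem star_symmetry (a b : A) :
    star (a * star a - b * star b) = a * star a - b * star b := by
  simp

variable {t u v : A}

theorem symmetry_mul_mean (h : CuntzRel a b) (ht : t = ((1 / Real.sqrt 2 : ℝ) : ℂ) • (a + b))
    (hu : u = a * star a - b * star b) : u * t = ((1 / Real.sqrt 2 : ℝ) : ℂ) • (a - b) := by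
  rw [ht, hu, mul_smul_comm, mul_add, h.symmetry_mul_left, h.symmetry_mul_right, ← sub_eq_add_neg]

theorem conj_mean (h : CuntzRel a b) (ht : t = ((1 / Real.sqrt 2 : ℝ) : ℂ) • (a + b))
    (hu : u = a * star a - b * star b) (hv : v = u * t * u) :
    v = ((1 / Real.sqrt 2 : ℝ) : ℂ) • ((a - b) * (a * star a - b * star b)) := by
  rw [hv, h.symmetry_mul_mean ht hu, smul_mul_assoc, ← hu]

theorem mean_conj_mean (h : CuntzRel a b) (ht : t = ((1 / Real.sqrt 2 : ℝ) : ℂ) • (a + b))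
    (hu : u = a * star a - b * star b) (hv : v = u * t * u) : CuntzRel t v := by
  have huu : u * u = 1 := hu ▸ h.symmetry_mul_self
  have hsu : star u = u := hu ▸ star_symmetry a b
  have htt : star t * t = 1 := by
    rw [ht, star_smul, star_inv_sqrt_two, smul_mul_smul_comm, inv_sqrt_two_mul_self, star_add,
      add_mul, mul_add, mul_add, h.1, h.2, h.orthogonal, h.orthogonal', add_zero, zero_add,
      ← two_smul ℂ, smul_smul]
    norm_num
  refine ⟨htt, ?_, ?_⟩
  · have : star v * v = u * star t * (u * u) * t * u := by
      rw [hv, star_mul, star_mul, hsu]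
      noncomm_ring
    rw [this, huu, mul_one, mul_assoc u, htt, mul_one, huu]
  -- Here `u * t` is the normalised difference, so the cross terms cancel against those of `t * star
  -- t`.
  · have hvv : v * star v = (u * t) * star (u * t) := by
      have : v * star v = u * t * (u * u) * star (u * t) := by
        rw [hv, star_mul (u * t), hsu]
        noncomm_ring
      rw [this, huu, mul_one]
    rw [hvv, h.symmetry_mul_mean ht hu, ht, star_smul, star_smul, star_inv_sqrt_two,
      smul_mul_smul_comm, smul_mul_smul_comm, inv_sqrt_two_mul_self, ← smul_add, star_add,
      star_sub]
    have : (a + b) * (star a + star b) + (a - b) * (star a - star b)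
        = (a * star a + b * star b) + (a * star a + b * star b) := by noncomm_ring
    rw [this, h.3, ← two_smul ℂ, smul_smul]
    norm_num

theorem fixedPointAlgebra_eq (h : CuntzRel a b) (htop : cstarGen a b = ⊤) {σ : A ≃⋆ₐ[ℂ] A}
    (ha : σ a = b) (hb : σ b = a) (ht : t = ((1 / Real.sqrt 2 : ℝ) : ℂ) • (a + b))
    (hu : u = a * star a - b * star b) (hv : v = u * t * u) :
    fixedPointAlgebra σ = cstarGen t v := by
  set c : ℂ := ((1 / Real.sqrt 2 : ℝ) : ℂ)
  have huu : u * u = 1 := hu ▸ h.symmetry_mul_self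
  have hsu : star u = u := hu ▸ star_symmetry a b
  have σt : σ t = t := by rw [ht, map_smul, map_add, ha, hb, add_comm]
  have σu : σ u = -u := by
    rw [hu, map_sub, map_mul, map_mul, map_star, map_star, ha, hb, neg_sub]
  have σv : σ v = v := by rw [hv, map_mul, map_mul, σt, σu]; noncomm_ring
  have hσ : Continuous σ := (StarAlgEquiv.isometry σ).continuous
  have hfix : cstarGen t v ≤ fixedPointAlgebra σ :=
    cstarGen_le (isClosed_eq hσ continuous_id) σt σv
  refine le_antisymm ?_ hfix
  have hconj : ∀ x ∈ cstarGen t v, u * x * u ∈ cstarGen t v := by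
    have : cstarGen t v ≤ (cstarGen t v).comap (StarAlgHom.conjSymmetry u huu hsu) := by
      refine cstarGen_le ((isClosed_cstarGen t v).preimage
        (StarAlgHom.conjSymmetry u huu hsu).continuous_of_cstarAlgebra) ?_ ?_
      · change u * t * u ∈ cstarGen t v
        exact hv ▸ right_mem_cstarGen t v
      · change u * v * u ∈ cstarGen t v
        have : u * v * u = (u * u) * t * (u * u) := by rw [hv]; noncomm_ring
        rw [this, huu, one_mul, mul_one]
        exact left_mem_cstarGen t v
    exact this
  have hvu : v * u = c • (a - b) := by
    rw [hv, mul_assoc, huu, mul_one, h.symmetry_mul_mean ht hu]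
  -- The witnesses come from `a = c t + c v u` and `b = c t - c v u`.
  have hadj : StarAlgebra.adjoin ℂ {a, b} ≤
      (cstarGen t v).adjoinSymmetry u huu hsu hconj := by
    have half (x : A) : x = c • c • (x + x) := by
      rw [smul_smul, inv_sqrt_two_mul_self, ← two_smul ℂ, smul_smul]
      norm_num
    refine StarAlgebra.adjoin_le ?_
    rintro _ (rfl | rfl)
    · refine ⟨_, SMulMemClass.smul_mem c (left_mem_cstarGen t v), _,
        SMulMemClass.smul_mem c (right_mem_cstarGen t v), ?_⟩
      rw [smul_mul_assoc, hvu, ht, ← smul_add, ← smul_add, add_add_sub_cancel]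
      exact half _
    · refine ⟨_, SMulMemClass.smul_mem c (left_mem_cstarGen t v), _,
        SMulMemClass.smul_mem (-c) (right_mem_cstarGen t v), ?_⟩
      rw [smul_mul_assoc, hvu, ht, neg_smul, ← sub_eq_add_neg, ← smul_sub, ← smul_sub,
        add_sub_sub_cancel]
      exact half _
  -- On the dense part `x = p + q u`, the sum is `2 p`; closedness extends membership to all `x`. A
  -- fixed `x` is half of its sum.
  have hsum : ∀ x : A, x + σ x ∈ cstarGen t v := by
    intro x
    have hx : x ∈ cstarGen a b := htop ▸ trivial
    refine closure_minimal (t := {y | y + σ y ∈ cstarGen t v}) ?_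
      ((isClosed_cstarGen t v).preimage (continuous_id.add hσ)) hx
    intro y hy
    obtain ⟨p, hp, q, hq, rfl⟩ := hadj hy
    have hp' : σ p = p := hfix hp
    have hq' : σ q = q := hfix hq
    have : p + q * u + σ (p + q * u) = p + p := by
      rw [map_add, map_mul, hp', hq', σu]
      noncomm_ring
    change _ ∈ cstarGen t v
    rw [this]
    exact add_mem hp hp
  intro x hx
  have hx' : σ x = x := hx
  have := SMulMemClass.smul_mem (1 / 2 : ℂ) (hsum x)
  rwa [hx', ← two_smul ℂ, smul_smul, one_div, inv_mul_cancel₀ two_ne_zero, one_smul] at this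

end CuntzRel

/-! ### Operators on Hilbert space -/

theorem IsCuntzPair.cuntzRel {H : Type*} [NormedAddCommGroup H] [InnerProductSpace ℂ H]
    [CompleteSpace H] {S₁ S₂ : H →L[ℂ] H} (h : IsCuntzPair S₁ S₂) : CuntzRel S₁ S₂ :=
  ⟨(ContinuousLinearMap.isometry_iff_adjoint_comp_self S₁).1 h.1,
    (ContinuousLinearMap.isometry_iff_adjoint_comp_self S₂).1 h.2, h.3⟩

theorem mainTheorem1 {H : Type*} [NormedAddCommGroup H] [InnerProductSpace ℂ H] [CompleteSpace H]
    [Nontrivial H] (S₁ S₂ : H →L[ℂ] H) (hS : IsCuntzPair S₁ S₂) :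
    -- there is a unique order two automorphism `σ` of `C*(S₁, S₂)` with `σ S₁ = S₂`
    (∃! σ : cstarGen S₁ S₂ ≃⋆ₐ[ℂ] cstarGen S₁ S₂,
      orderOf σ = 2 ∧ σ (cstarGen.fst S₁ S₂) = cstarGen.snd S₁ S₂) ∧
    -- and its fixed-point algebra is as follows
    ∀ σ : cstarGen S₁ S₂ ≃⋆ₐ[ℂ] cstarGen S₁ S₂, orderOf σ = 2 →
      σ (cstarGen.fst S₁ S₂) = cstarGen.snd S₁ S₂ →
      ∀ s₁ s₂ T U V : cstarGen S₁ S₂,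
        s₁ = cstarGen.fst S₁ S₂ → s₂ = cstarGen.snd S₁ S₂ →
        T = ((1 / Real.sqrt 2 : ℝ) : ℂ) • (s₁ + s₂) →
        U = s₁ * star s₁ - s₂ * star s₂ →
        V = U * T * U →
        V = ((1 / Real.sqrt 2 : ℝ) : ℂ) • ((s₁ - s₂) * (s₁ * star s₁ - s₂ * star s₂)) ∧
        fixedPointAlgebra σ = cstarGen T V ∧
        Nonempty (fixedPointAlgebra σ ≃⋆ₐ[ℂ] cstarGen S₁ S₂) ∧
        -- `O₂` does not depend on the choice of the two isometries that represent it
        ∀ (K : Type*) [NormedAddCommGroup K] [InnerProductSpace ℂ K] [CompleteSpace K]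
          [Nontrivial K] (R₁ R₂ : K →L[ℂ] K), IsCuntzPair R₁ R₂ →
          Nonempty (fixedPointAlgebra σ ≃⋆ₐ[ℂ] cstarGen R₁ R₂) := by
  -- Closedness supplies the C*-algebra structure on the subalgebra.
  have := isClosed_cstarGen S₁ S₂
  have h := hS.cuntzRel
  refine ⟨h.existsUnique_swap, ?_⟩
  rintro σ hσ hσ₁ s₁ s₂ T U V rfl rfl hT hU hV
  have hσ₂ := CuntzRel.apply_snd_of_orderOf hσ hσ₁
  have hfix := h.fst_snd.fixedPointAlgebra_eq (cstarGen_fst_snd_eq_top S₁ S₂) hσ₁ hσ₂ hT hU hV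
  have hTV := h.fst_snd.mean_conj_mean hT hU hV
  rw [hfix]
  refine ⟨h.fst_snd.conj_mean hT hU hV, rfl, ?_, ?_⟩
  · obtain ⟨e, -⟩ := hTV.exists_equiv h
    exact ⟨e⟩
  · intro K _ _ _ _ R₁ R₂ hR
    obtain ⟨e, -⟩ := hTV.exists_equiv hR.cuntzRel
    exact ⟨e⟩
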